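/- All formulas are built from the variables $p_0,p_1,p_2,\dots$, and consequence relations $\Gamma\vdash\varphi$ are defined by derivability from an arbitrary set of premises $\Gamma$. **The logic $\mathcal S$** (Nelson) has the language $\langle\land,\lor,\Rightarrow,\neg,0\rangle$. Abbreviate $1:=\neg 0$, $\varphi\Leftrightarrow\psi:=(\varphi\Rightarrow\psi)\land(\psi\Rightarrow\varphi)$, $\varphi\Rightarrow^2\psi:=\varphi\Rightarrow(\varphi\Rightarrow\psi)$, $\varphi^2:=\neg(\varphi\Rightarrow\neg\varphi)$. For a finite list $G=(\varphi_1,\dots,\varphi_n)$, $n\ge 0$, let $G\Rightarrow\varphi:=\varphi_1\Rightarrow(\cdots\Rightarrow(\varphi_n\Rightarrow\varphi)\cdots)$, and similarly $G\Rightarrow^2\varphi$. The axioms are all instances of $\varphi\Rightarrow\varphi$; $0\Rightarrow\psi$; $\neg\varphi\Rightarrow(\varphi\Rightarrow 0)$; $1$; $(\varphi\Rightarrow\psi)\Leftrightarrow(\neg\psi\Rightarrow\neg\varphi)$. The rules, written premises $/$ conclusion and applicable to any derived formulas, are $G\Rightarrow(\varphi\Rightarrow(\psi\Rightarrow\gamma))\,/\,G\Rightarrow(\psi\Rightarrow(\varphi\Rightarrow\gamma))$;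 $\varphi\Rightarrow(\varphi\Rightarrow(\varphi\Rightarrow\gamma))\,/\,\varphi\Rightarrow(\varphi\Rightarrow\gamma)$; $G\Rightarrow\varphi,\ \varphi\Rightarrow\gamma\,/\,G\Rightarrow\gamma$; $G\Rightarrow\varphi,\ \psi\Rightarrow\gamma\,/\,G\Rightarrow((\varphi\Rightarrow\psi)\Rightarrow\gamma)$; $\gamma\,/\,\varphi\Rightarrow\gamma$; $\varphi\Rightarrow\gamma\,/\,(\varphi\land\psi)\Rightarrow\gamma$; $\psi\Rightarrow\gamma\,/\,(\varphi\land\psi)\Rightarrow\gamma$; $G\Rightarrow\varphi,\ G\Rightarrow\psi\,/\,G\Rightarrow(\varphi\land\psi)$; $\varphi\Rightarrow\gamma,\ \psi\Rightarrow\gamma\,/\,(\varphi\lor\psi)\Rightarrow\gamma$; $\varphi\Rightarrow^2\gamma,\ \psi\Rightarrow^2\gamma\,/\,(\varphi\lor\psi)\Rightarrow^2\gamma$; $G\Rightarrow\varphi\,/\,G\Rightarrow(\varphi\lor\psi)$; $G\Rightarrow\psi\,/\,G\Rightarrow(\varphi\lor\psi)$; $(\varphi\land\neg\psi)\Rightarrow\gamma\,/\,\neg(\varphi\Rightarrow\psi)\Rightarrow\gamma$;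 $G\Rightarrow^2(\varphi\land\neg\psi)\,/\,G\Rightarrow^2\neg(\varphi\Rightarrow\psi)$; $(\neg\varphi\lor\neg\psi)\Rightarrow\gamma\,/\,\neg(\varphi\land\psi)\Rightarrow\gamma$; $G\Rightarrow(\neg\varphi\lor\neg\psi)\,/\,G\Rightarrow\neg(\varphi\land\psi)$; $(\neg\varphi\land\neg\psi)\Rightarrow\gamma\,/\,\neg(\varphi\lor\psi)\Rightarrow\gamma$; $G\Rightarrow(\neg\varphi\land\neg\psi)\,/\,G\Rightarrow\neg(\varphi\lor\psi)$; $\varphi\Rightarrow\gamma\,/\,\neg\neg\varphi\Rightarrow\gamma$; $G\Rightarrow\varphi\,/\,G\Rightarrow\neg\neg\varphi$. Let $\mathcal S+(\mathrm{Nelson})$ be $\mathcal S$ with all instances of $((\varphi^2\Rightarrow\psi)\land((\neg\psi)^2\Rightarrow\neg\varphi))\Rightarrow(\varphi\Rightarrow\psi)$ added as axioms. **The logic $\mathcal N3$** has the language $\langle\land,\lor,\to,\neg\rangle$, modus ponens (for $\to$) as its only rule, and the following axiom schemata, where $\varphi\leftrightarrow\psi:=(\varphi\to\psi)\land(\psi\to\varphi)$: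 $\varphi\to(\psi\to\varphi)$; $(\varphi\to(\psi\to\gamma))\to((\varphi\to\psi)\to(\varphi\to\gamma))$; $(\varphi\land\psi)\to\varphi$; $(\varphi\land\psi)\to\psi$; $(\varphi\to\psi)\to((\varphi\to\gamma)\to(\varphi\to(\psi\land\gamma)))$; $\varphi\to(\varphi\lor\psi)$; $\psi\to(\varphi\lor\psi)$; $(\varphi\to\gamma)\to((\psi\to\gamma)\to((\varphi\lor\psi)\to\gamma))$; $\neg\neg\varphi\leftrightarrow\varphi$; $\neg(\varphi\lor\psi)\leftrightarrow(\neg\varphi\land\neg\psi)$; $\neg(\varphi\land\psi)\leftrightarrow(\neg\varphi\lor\neg\psi)$; $\neg(\varphi\to\psi)\leftrightarrow(\varphi\land\neg\psi)$; $\neg\varphi\to(\varphi\to\psi)$. In $\mathcal N3$ one defines strong implication $\varphi\Rightarrow\psi:=(\varphi\to\psi)\land(\neg\psi\to\neg\varphi)$, and $\varphi\Leftrightarrow\psi$, $\varphi^2$ from it as above, and the constants $1:=p_0\to p_0$, $0:=\neg 1$. Formulas of the language $\langle\land,\lor,\Rightarrow,\neg,0,1\rangle$ can thus be read in $\mathcal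 S$ (with $1$ defined) and in $\mathcal N3$ (with $\Rightarrow,0,1$ defined). **Proposition.** Over the language $\langle\land,\lor,\Rightarrow,\neg,0,1\rangle$, $\mathcal N3$ is the axiomatic strengthening of $\mathcal S$ by the Nelson axiom. That is, for every set $\Gamma\cup\{\varphi\}$ of formulas of this language, $$\Gamma\vdash_{\mathcal N3}\varphi\iff\Gamma\vdash_{\mathcal S+(\mathrm{Nelson})}\varphi ;$$ and the primitive implication of $\mathcal N3$ is definable in this language: $\vdash_{\mathcal N3}(\varphi\to\psi)\Leftrightarrow(\varphi^2\Rightarrow\psi)$ for all formulas $\varphi,\psi$ of $\mathcal N3$. -/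

import Mathlib

/-! Formulas over the propositional variables `p₀, p₁, p₂, …`, indexed by `ℕ`. -/

/-- Formulas of the language `⟨∧, ∨, ⇒, ¬, 0⟩` of Nelson's logic `S`. -/
inductive SForm : Type
  | var (n : ℕ) : SForm
  | and (φ ψ : SForm) : SForm
  | or (φ ψ : SForm) : SForm
  | imp (φ ψ : SForm) : SForm
  | neg (φ : SForm) : SForm
  | zero : SForm

namespace SForm

/-- `1 := ¬0`. -/
def one : SForm := neg zero

/-- `φ ⇔ ψ := (φ ⇒ ψ) ∧ (ψ ⇒ φ)`. -/
def iff (φ ψ : SForm) : SForm := and (imp φ ψ) (imp ψ φ)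

/-- `φ ⇒² ψ := φ ⇒ (φ ⇒ ψ)`. -/
def imp2 (φ ψ : SForm) : SForm := imp φ (imp φ ψ)

/-- `φ * ψ := ¬(φ ⇒ ¬ψ)`. -/
def fuse (φ ψ : SForm) : SForm := neg (imp φ (neg ψ))

/-- `φ² := φ * φ`. -/
def sq (φ : SForm) : SForm := fuse φ φ

/-- `G ⇒ φ`, that is `φ₁ ⇒ (φ₂ ⇒ (… ⇒ (φₙ ⇒ φ)…))` for the list `G = (φ₁, …, φₙ)`. -/
def impL (G : List SForm) (φ : SForm) : SForm := G.foldr imp φ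

/-- `G ⇒² φ`, that is `φ₁ ⇒² (φ₂ ⇒² (… ⇒² (φₙ ⇒² φ)…))` for the list `G = (φ₁, …, φₙ)`. -/
def imp2L (G : List SForm) (φ : SForm) : SForm := G.foldr imp2 φ

/-- The instance of the Nelson axiom at `φ, ψ`:
`((φ² ⇒ ψ) ∧ ((¬ψ)² ⇒ ¬φ)) ⇒ (φ ⇒ ψ)`. -/
def nelson (φ ψ : SForm) : SForm :=
  imp (and (imp (sq φ) ψ) (imp (sq (neg ψ)) (neg φ))) (imp φ ψ)

end SForm

open SForm in
/-- `SDerives Ax Γ φ`: the formula `φ` is derivable from the premises `Γ` in Nelson's Hilbert-style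
calculus for `S`, to which the members of `Ax` have been added as axioms. -/
inductive SDerives (Ax Γ : Set SForm) : SForm → Prop
  | extra {φ} : φ ∈ Ax → SDerives Ax Γ φ
  | prem {φ} : φ ∈ Γ → SDerives Ax Γ φ
  -- axioms
  | A1 (φ) : SDerives Ax Γ (imp φ φ)
  | A2 (ψ) : SDerives Ax Γ (imp zero ψ)
  | A3 (φ) : SDerives Ax Γ (imp (neg φ) (imp φ zero))
  | A4 : SDerives Ax Γ one
  | A5 (φ ψ) : SDerives Ax Γ (iff (imp φ ψ) (imp (neg ψ) (neg φ)))
  -- rules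
  | P (G : List SForm) {φ ψ γ} :
      SDerives Ax Γ (impL G (imp φ (imp ψ γ))) → SDerives Ax Γ (impL G (imp ψ (imp φ γ)))
  | C {φ γ} : SDerives Ax Γ (imp φ (imp φ (imp φ γ))) → SDerives Ax Γ (imp φ (imp φ γ))
  | E (G : List SForm) {φ γ} :
      SDerives Ax Γ (impL G φ) → SDerives Ax Γ (imp φ γ) → SDerives Ax Γ (impL G γ)
  | impl (G : List SForm) {φ ψ γ} :
      SDerives Ax Γ (impL G φ) → SDerives Ax Γ (imp ψ γ) →
      SDerives Ax Γ (impL G (imp (imp φ ψ) γ))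
  | impr (φ) {γ} : SDerives Ax Γ γ → SDerives Ax Γ (imp φ γ)
  | andl1 {φ} (ψ) {γ} : SDerives Ax Γ (imp φ γ) → SDerives Ax Γ (imp (and φ ψ) γ)
  | andl2 (φ) {ψ γ} : SDerives Ax Γ (imp ψ γ) → SDerives Ax Γ (imp (and φ ψ) γ)
  | andr (G : List SForm) {φ ψ} :
      SDerives Ax Γ (impL G φ) → SDerives Ax Γ (impL G ψ) → SDerives Ax Γ (impL G (and φ ψ))
  | orl1 {φ ψ γ} :
      SDerives Ax Γ (imp φ γ) → SDerives Ax Γ (imp ψ γ) → SDerives Ax Γ (imp (or φ ψ) γ)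
  | orl2 {φ ψ γ} :
      SDerives Ax Γ (imp2 φ γ) → SDerives Ax Γ (imp2 ψ γ) → SDerives Ax Γ (imp2 (or φ ψ) γ)
  | orr1 (G : List SForm) {φ} (ψ) : SDerives Ax Γ (impL G φ) → SDerives Ax Γ (impL G (or φ ψ))
  | orr2 (G : List SForm) (φ) {ψ} : SDerives Ax Γ (impL G ψ) → SDerives Ax Γ (impL G (or φ ψ))
  | negimpl {φ ψ γ} :
      SDerives Ax Γ (imp (and φ (neg ψ)) γ) → SDerives Ax Γ (imp (neg (imp φ ψ)) γ)
  | negimpr (G : List SForm) {φ ψ} :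
      SDerives Ax Γ (imp2L G (and φ (neg ψ))) → SDerives Ax Γ (imp2L G (neg (imp φ ψ)))
  | negandl {φ ψ γ} :
      SDerives Ax Γ (imp (or (neg φ) (neg ψ)) γ) → SDerives Ax Γ (imp (neg (and φ ψ)) γ)
  | negandr (G : List SForm) {φ ψ} :
      SDerives Ax Γ (impL G (or (neg φ) (neg ψ))) → SDerives Ax Γ (impL G (neg (and φ ψ)))
  | negorl {φ ψ γ} :
      SDerives Ax Γ (imp (and (neg φ) (neg ψ)) γ) → SDerives Ax Γ (imp (neg (or φ ψ)) γ)
  | negorr (G : List SForm) {φ ψ} :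
      SDerives Ax Γ (impL G (and (neg φ) (neg ψ))) → SDerives Ax Γ (impL G (neg (or φ ψ)))
  | negnegl {φ γ} : SDerives Ax Γ (imp φ γ) → SDerives Ax Γ (imp (neg (neg φ)) γ)
  | negnegr (G : List SForm) {φ} :
      SDerives Ax Γ (impL G φ) → SDerives Ax Γ (impL G (neg (neg φ)))

/-- The axiomatic strengthening of `S` by the Nelson axiom schema. -/
def SNelson (Γ : Set SForm) (φ : SForm) : Prop :=
  SDerives {χ | ∃ α β : SForm, χ = SForm.nelson α β} Γ φ

/-- Formulas of the language `⟨∧, ∨, →, ¬⟩` of `N4` and `N3`; `→` is the weak implication. -/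
inductive NForm : Type
  | var (n : ℕ) : NForm
  | and (φ ψ : NForm) : NForm
  | or (φ ψ : NForm) : NForm
  | wimp (φ ψ : NForm) : NForm
  | neg (φ : NForm) : NForm

namespace NForm

/-- `φ ↔ ψ := (φ → ψ) ∧ (ψ → φ)`. -/
def wiff (φ ψ : NForm) : NForm := and (wimp φ ψ) (wimp ψ φ)

/-- Strong implication `φ ⇒ ψ := (φ → ψ) ∧ (¬ψ → ¬φ)`. -/
def imp (φ ψ : NForm) : NForm := and (wimp φ ψ) (wimp (neg ψ) (neg φ))

/-- `φ ⇔ ψ := (φ ⇒ ψ) ∧ (ψ ⇒ φ)`. -/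
def iff (φ ψ : NForm) : NForm := and (imp φ ψ) (imp ψ φ)

/-- `φ² := ¬(φ ⇒ ¬φ)`. -/
def sq (φ : NForm) : NForm := neg (imp φ (neg φ))

/-- `1 := p₀ → p₀`. (All formulas `φ → φ` are equivalent in `N3`, so the variable is immaterial.) -/
def one : NForm := wimp (var 0) (var 0)

/-- `0 := ¬1`. -/
def zero : NForm := neg one

end NForm

open NForm in
/-- `NDerives Ax Γ φ`: the formula `φ` is derivable from the premises `Γ` in the Hilbert-style
calculus for `N4`, to which the members of `Ax` have been added as axioms. -/
inductive NDerives (Ax Γ : Set NForm) : NForm → Prop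
  | extra {φ} : φ ∈ Ax → NDerives Ax Γ φ
  | prem {φ} : φ ∈ Γ → NDerives Ax Γ φ
  | N1 (φ ψ) : NDerives Ax Γ (wimp φ (wimp ψ φ))
  | N2 (φ ψ γ) :
      NDerives Ax Γ (wimp (wimp φ (wimp ψ γ)) (wimp (wimp φ ψ) (wimp φ γ)))
  | N3 (φ ψ) : NDerives Ax Γ (wimp (and φ ψ) φ)
  | N4 (φ ψ) : NDerives Ax Γ (wimp (and φ ψ) ψ)
  | N5 (φ ψ γ) :
      NDerives Ax Γ (wimp (wimp φ ψ) (wimp (wimp φ γ) (wimp φ (and ψ γ))))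
  | N6 (φ ψ) : NDerives Ax Γ (wimp φ (or φ ψ))
  | N7 (φ ψ) : NDerives Ax Γ (wimp ψ (or φ ψ))
  | N8 (φ ψ γ) :
      NDerives Ax Γ (wimp (wimp φ γ) (wimp (wimp ψ γ) (wimp (or φ ψ) γ)))
  | N9 (φ) : NDerives Ax Γ (wiff (neg (neg φ)) φ)
  | N10 (φ ψ) : NDerives Ax Γ (wiff (neg (or φ ψ)) (and (neg φ) (neg ψ)))
  | N11 (φ ψ) : NDerives Ax Γ (wiff (neg (and φ ψ)) (or (neg φ) (neg ψ)))
  | N12 (φ ψ) : NDerives Ax Γ (wiff (neg (wimp φ ψ)) (and φ (neg ψ)))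
  | mp {φ ψ} : NDerives Ax Γ φ → NDerives Ax Γ (wimp φ ψ) → NDerives Ax Γ ψ

/-- `N3`: the axiomatic strengthening of `N4` by the schema `¬φ → (φ → ψ)`. -/
def N3Derives (Γ : Set NForm) (φ : NForm) : Prop :=
  NDerives {χ | ∃ α β : NForm, χ = NForm.wimp (NForm.neg α) (NForm.wimp α β)} Γ φ

/-- Formulas of the common language `⟨∧, ∨, ⇒, ¬, 0, 1⟩`. -/
inductive Form : Type
  | var (n : ℕ) : Form
  | and (φ ψ : Form) : Form
  | or (φ ψ : Form) : Form
  | imp (φ ψ : Form) : Form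
  | neg (φ : Form) : Form
  | zero : Form
  | one : Form

namespace Form

/-- Reading of the common language in `S`, where `1` is the defined constant `¬0`. -/
def toS : Form → SForm
  | var n => SForm.var n
  | and φ ψ => SForm.and φ.toS ψ.toS
  | or φ ψ => SForm.or φ.toS ψ.toS
  | imp φ ψ => SForm.imp φ.toS ψ.toS
  | neg φ => SForm.neg φ.toS
  | zero => SForm.zero
  | one => SForm.one

/-- Reading of the common language in `N3`, where `⇒` is the defined strong implication and
`0`, `1` are the defined constants. -/
def toN : Form → NForm
  | var n => NForm.var n
  | and φ ψ => NForm.and φ.toN ψ.toN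
  | or φ ψ => NForm.or φ.toN ψ.toN
  | imp φ ψ => NForm.imp φ.toN ψ.toN
  | neg φ => NForm.neg φ.toN
  | zero => NForm.zero
  | one => NForm.one

end Form

/-! Each calculus is interpreted in the other. On the `N3` side the deduction theorem turns premise
sets, ordered by inclusion, into Kripke-style worlds: `→` quantifies over larger premise sets, and
the negation of each connective decomposes by its own axiom. Explosion of `¬φ` with `φ` then makes
`φ ⇒ (φ ⇒ ψ)` amount to `φ → ψ` (`imp2_iff`), and the rules of `S` are checked by unfolding
(`of_sDerives`). Conversely, `→` is read in `S` as `⇒²`. The rule `C` makes doubled antecedents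
freely reusable (`contract`), so `⇒²` behaves as an intuitionistic implication and the axioms of
`N3` become derivable. The Nelson axiom serves only to recover `φ ⇒ ψ` from `φ ⇒² ψ` and `¬ψ ⇒² ¬φ`
(`strong_imp`). Each composite of translations returns an equivalent formula (`toN_toS`, `toS_toN`).
-/

namespace N3Derives

/-! ### Premise sets as worlds for `N3`. -/

open NForm

variable {Γ Δ : Set NForm} {φ ψ χ : NForm}

theorem mp (h₁ : N3Derives Γ φ) (h₂ : N3Derives Γ (wimp φ ψ)) : N3Derives Γ ψ :=
  NDerives.mp h₁ h₂

theorem mono (hΓ : Γ ⊆ Δ) (h : N3Derives Γ φ) : N3Derives Δ φ := by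
  unfold N3Derives at *
  induction h with
  | extra h => exact .extra h
  | prem h => exact .prem (hΓ h)
  | mp _ _ ih₁ ih₂ => exact .mp ih₁ ih₂
  | N1 => exact .N1 ..
  | N2 => exact .N2 ..
  | N3 => exact .N3 ..
  | N4 => exact .N4 ..
  | N5 => exact .N5 ..
  | N6 => exact .N6 ..
  | N7 => exact .N7 ..
  | N8 => exact .N8 ..
  | N9 => exact .N9 ..
  | N10 => exact .N10 ..
  | N11 => exact .N11 ..
  | N12 => exact .N12 ..

theorem const (h : N3Derives Γ ψ) : N3Derives Γ (wimp φ ψ) :=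
  h.mp (NDerives.N1 _ _)

theorem refl (Γ : Set NForm) (φ : NForm) : N3Derives Γ (wimp φ φ) :=
  mp (NDerives.N1 φ φ) (mp (NDerives.N1 φ (wimp φ φ)) (NDerives.N2 _ _ _))

theorem deduction (h : N3Derives (insert φ Γ) ψ) : N3Derives Γ (wimp φ ψ) := by
  unfold N3Derives at h
  induction h with
  | extra h => exact const (NDerives.extra h)
  | prem h =>
    rcases h with rfl | h
    · exact refl _ _
    · exact const (NDerives.prem h)
  | mp _ _ ih₁ ih₂ => exact ih₁.mp (ih₂.mp (NDerives.N2 _ _ _))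
  | N1 => exact const (NDerives.N1 ..)
  | N2 => exact const (NDerives.N2 ..)
  | N3 => exact const (NDerives.N3 ..)
  | N4 => exact const (NDerives.N4 ..)
  | N5 => exact const (NDerives.N5 ..)
  | N6 => exact const (NDerives.N6 ..)
  | N7 => exact const (NDerives.N7 ..)
  | N8 => exact const (NDerives.N8 ..)
  | N9 => exact const (NDerives.N9 ..)
  | N10 => exact const (NDerives.N10 ..)
  | N11 => exact const (NDerives.N11 ..)
  | N12 => exact const (NDerives.N12 ..)

theorem wimp_iff : N3Derives Γ (wimp φ ψ) ↔
    ∀ Δ, Γ ⊆ Δ → N3Derives Δ φ → N3Derives Δ ψ :=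
  ⟨fun h _ hΔ hφ => hφ.mp (h.mono hΔ),
    fun h => deduction (h _ (Set.subset_insert _ _) (NDerives.prem (Set.mem_insert _ _)))⟩

theorem and_iff : N3Derives Γ (and φ ψ) ↔ N3Derives Γ φ ∧ N3Derives Γ ψ := by
  refine ⟨fun h => ⟨h.mp (NDerives.N3 _ _), h.mp (NDerives.N4 _ _)⟩, fun ⟨h₁, h₂⟩ => ?_⟩
  exact h₁.mp (mp h₂.const (mp (refl Γ φ) (NDerives.N5 _ _ _)))

theorem or_left (h : N3Derives Γ φ) : N3Derives Γ (or φ ψ) := h.mp (NDerives.N6 _ _)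

theorem or_right (h : N3Derives Γ ψ) : N3Derives Γ (or φ ψ) := h.mp (NDerives.N7 _ _)

theorem or_elim (h : N3Derives Γ (or φ ψ))
    (h₁ : ∀ Δ, Γ ⊆ Δ → N3Derives Δ φ → N3Derives Δ χ)
    (h₂ : ∀ Δ, Γ ⊆ Δ → N3Derives Δ ψ → N3Derives Δ χ) : N3Derives Γ χ :=
  h.mp (mp (wimp_iff.2 h₂) (mp (wimp_iff.2 h₁) (NDerives.N8 _ _ _)))

/-- Premise sets need not be prime, so disjunction gets a second-order description, usable for
rewriting inside disjuncts. -/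
theorem or_iff : N3Derives Γ (or φ ψ) ↔
    ∀ χ, (∀ Δ, Γ ⊆ Δ → N3Derives Δ φ → N3Derives Δ χ) →
      (∀ Δ, Γ ⊆ Δ → N3Derives Δ ψ → N3Derives Δ χ) → N3Derives Γ χ :=
  ⟨fun h _ => h.or_elim, fun h => h _ (fun _ _ => or_left) (fun _ _ => or_right)⟩

theorem wiff_iff (h : N3Derives Γ (wiff φ ψ)) : N3Derives Γ φ ↔ N3Derives Γ ψ :=
  have h := and_iff.1 h
  ⟨fun h' => h'.mp h.1, fun h' => h'.mp h.2⟩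

theorem neg_neg_iff : N3Derives Γ (neg (neg φ)) ↔ N3Derives Γ φ :=
  wiff_iff (NDerives.N9 _)

theorem neg_or_iff : N3Derives Γ (neg (or φ ψ)) ↔ N3Derives Γ (neg φ) ∧ N3Derives Γ (neg ψ) :=
  (wiff_iff (NDerives.N10 _ _)).trans and_iff

theorem neg_and_iff : N3Derives Γ (neg (and φ ψ)) ↔ N3Derives Γ (or (neg φ) (neg ψ)) :=
  wiff_iff (NDerives.N11 _ _)

theorem neg_wimp_iff : N3Derives Γ (neg (wimp φ ψ)) ↔ N3Derives Γ φ ∧ N3Derives Γ (neg ψ) :=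
  (wiff_iff (NDerives.N12 _ _)).trans and_iff

theorem exfalso (h₁ : N3Derives Γ (neg φ)) (h₂ : N3Derives Γ φ) : N3Derives Γ ψ :=
  h₂.mp (mp h₁ (NDerives.extra ⟨φ, ψ, rfl⟩))

theorem imp_iff : N3Derives Γ (imp φ ψ) ↔ ∀ Δ, Γ ⊆ Δ →
    (N3Derives Δ φ → N3Derives Δ ψ) ∧ (N3Derives Δ (neg ψ) → N3Derives Δ (neg φ)) := by
  unfold imp
  rw [and_iff, wimp_iff, wimp_iff]
  grind

theorem imp_mp (h₁ : N3Derives Γ (imp φ ψ)) (h₂ : N3Derives Γ φ) : N3Derives Γ ψ :=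
  h₂.mp (and_iff.1 h₁).1

theorem imp_mt (h₁ : N3Derives Γ (imp φ ψ)) (h₂ : N3Derives Γ (neg ψ)) :
    N3Derives Γ (neg φ) :=
  h₂.mp (and_iff.1 h₁).2

/-- Both conjuncts of `φ ⇒ ψ` have the same refutation, up to order and double negation. -/
theorem neg_imp_iff : N3Derives Γ (neg (imp φ ψ)) ↔ N3Derives Γ φ ∧ N3Derives Γ (neg ψ) := by
  unfold imp
  rw [neg_and_iff]
  refine ⟨fun h => and_iff.1 (h.or_elim (fun Δ _ h' => ?_) (fun Δ _ h' => ?_)),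
    fun h => or_left (neg_wimp_iff.2 h)⟩
  · exact and_iff.2 (neg_wimp_iff.1 h')
  · rw [neg_wimp_iff, neg_neg_iff] at h'
    exact and_iff.2 h'.symm

theorem sq_iff : N3Derives Γ (NForm.sq φ) ↔ N3Derives Γ φ := by
  simp [NForm.sq, neg_imp_iff, neg_neg_iff]

theorem one (Γ : Set NForm) : N3Derives Γ NForm.one := refl _ _

theorem iff_iff : N3Derives Γ (iff φ ψ) ↔ ∀ Δ, Γ ⊆ Δ →
    (N3Derives Δ φ ↔ N3Derives Δ ψ) ∧ (N3Derives Δ (neg φ) ↔ N3Derives Δ (neg ψ)) := by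
  unfold iff
  rw [and_iff, imp_iff, imp_iff]
  grind

theorem wimp_iff_imp_sq (φ ψ : NForm) :
    N3Derives Γ (NForm.iff (wimp φ ψ) (imp (NForm.sq φ) ψ)) := by
  rw [iff_iff]
  intro Δ _
  rw [neg_wimp_iff, neg_imp_iff, sq_iff, wimp_iff, imp_iff]
  refine ⟨⟨fun h E hE => ⟨fun h' => h E hE (sq_iff.1 h'), fun h' => ?_⟩,
    fun h E hE h' => (h E hE).1 (sq_iff.2 h')⟩, Iff.rfl⟩
  -- Refuting `φ²` means deriving `φ ⇒ ¬φ`; given `¬ψ` and `φ → ψ`, assuming `φ` explodes.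
  rw [NForm.sq, neg_neg_iff, imp_iff]
  intro F hF
  rw [neg_neg_iff]
  exact ⟨fun hφ => exfalso (h'.mono hF) (h F (hE.trans hF) hφ),
    fun hφ => exfalso (h'.mono hF) (h F (hE.trans hF) hφ)⟩

theorem imp2_iff : N3Derives Γ (imp φ (imp φ ψ)) ↔ N3Derives Γ (wimp φ ψ) := by
  rw [wimp_iff, imp_iff]
  refine ⟨fun h Δ hΔ hφ => (imp_iff.1 ((h Δ hΔ).1 hφ) Δ subset_rfl).1 hφ,
    fun h Δ hΔ => ⟨fun hφ => imp_iff.2 fun E hE => ⟨fun _ => ?_, fun hψ => ?_⟩, fun hψ => ?_⟩⟩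
  · exact (h Δ hΔ hφ).mono hE
  · exact exfalso hψ ((h Δ hΔ hφ).mono hE)
  · rw [neg_imp_iff] at hψ
    exact exfalso hψ.2 (h Δ hΔ hψ.1)

theorem imp_trans (h₁ : N3Derives Γ (imp φ ψ)) (h₂ : N3Derives Γ (imp ψ χ)) :
    N3Derives Γ (imp φ χ) := by
  rw [imp_iff] at *
  grind

end N3Derives

/-! ### Soundness of `S` with the Nelson axiom in `N3`. -/

namespace SForm

/-- Reading of the formulas of `S` in `N3`. -/
def toN : SForm → NForm
  | var n => NForm.var n
  | and φ ψ => NForm.and φ.toN ψ.toN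
  | or φ ψ => NForm.or φ.toN ψ.toN
  | imp φ ψ => NForm.imp φ.toN ψ.toN
  | neg φ => NForm.neg φ.toN
  | zero => NForm.zero

end SForm

namespace N3Derives

open NForm

variable {Γ Δ : Set NForm} {φ ψ χ : NForm}

theorem imp_mono (h : N3Derives Γ (imp φ ψ)) :
    N3Derives Γ (imp (imp χ φ) (imp χ ψ)) := by
  rw [imp_iff] at *
  intro Δ hΔ
  rw [imp_iff, imp_iff, neg_imp_iff, neg_imp_iff]
  grind

theorem imp_swap : N3Derives Γ (imp (imp φ (imp ψ χ)) (imp ψ (imp φ χ))) := by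
  refine imp_iff.2 fun Δ _ => ⟨fun h => imp_iff.2 fun E hE => ⟨fun hψ => imp_iff.2 fun F hF =>
    ⟨fun hφ => ?_, fun hχ => ?_⟩, fun h' => ?_⟩, fun h' => ?_⟩
  · exact imp_mp (imp_mp (h.mono (hE.trans hF)) hφ) (hψ.mono hF)
  · exact imp_mt (h.mono (hE.trans hF)) (neg_imp_iff.2 ⟨hψ.mono hF, hχ⟩)
  · have h' := neg_imp_iff.1 h'
    exact imp_mt (imp_mp (h.mono hE) h'.1) h'.2
  · simp only [neg_imp_iff] at h' ⊢
    exact and_left_comm.1 h'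

theorem imp_imp_and :
    N3Derives Γ (imp (and (imp φ ψ) (imp φ χ)) (imp φ (and ψ χ))) := by
  simp only [imp_iff, neg_imp_iff, neg_and_iff, and_iff]
  refine fun Δ _ => ⟨fun h E hE => ⟨by grind, fun h' => h'.or_elim ?_ ?_⟩, fun h => ?_⟩
  · exact fun F hF => (h.1 F (hE.trans hF)).2
  · exact fun F hF => (h.2 F (hE.trans hF)).2
  · refine h.2.or_elim (fun F hF h' => or_left ?_) (fun F hF h' => or_right ?_)
    · exact neg_imp_iff.2 ⟨h.1.mono hF, h'⟩
    · exact neg_imp_iff.2 ⟨h.1.mono hF, h'⟩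

/-- Reduces a rule with context `G` to a single strong implication. -/
theorem impL_mono {α β : SForm} (G : List SForm) (h : N3Derives Γ (imp α.toN β.toN)) :
    N3Derives Γ (imp (SForm.impL G α).toN (SForm.impL G β).toN) := by
  induction G with
  | nil => exact h
  | cons _ _ ih => exact imp_mono ih

theorem impL_and {α β : SForm} (G : List SForm) :
    N3Derives Γ (imp (and (SForm.impL G α).toN (SForm.impL G β).toN)
      (SForm.impL G (SForm.and α β)).toN) := by
  induction G with
  | nil => exact imp_iff.2 fun _ _ => ⟨id, id⟩
  | cons _ _ ih => exact imp_trans imp_imp_and (imp_mono ih)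

/-- Weak implication suffices under `⇒²`. The right rule for `¬(φ ⇒ ψ)` needs this, since `(φ ∧ ¬ψ)
⇒ ¬(φ ⇒ ψ)` is not valid in general. -/
theorem imp2L_mono {α β : SForm} (G : List SForm) (h : N3Derives Γ (wimp α.toN β.toN)) :
    N3Derives Γ (wimp (SForm.imp2L G α).toN (SForm.imp2L G β).toN) := by
  induction G with
  | nil => exact h
  | cons _ _ ih =>
    rw [wimp_iff]
    intro Δ hΔ h'
    refine imp2_iff.2 (wimp_iff.2 fun E hE hx => ?_)
    exact wimp_iff.1 ih E (hΔ.trans hE) (wimp_iff.1 (imp2_iff.1 h') E hE hx)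

theorem imp_or {α β : NForm} (h₁ : N3Derives Γ (imp α χ)) (h₂ : N3Derives Γ (imp β χ)) :
    N3Derives Γ (imp (or α β) χ) := by
  rw [imp_iff] at *
  refine fun Δ hΔ => ⟨fun h => h.or_elim (fun E hE => (h₁ E (hΔ.trans hE)).1)
    (fun E hE => (h₂ E (hΔ.trans hE)).1), fun h => neg_or_iff.2 ⟨(h₁ Δ hΔ).2 h, (h₂ Δ hΔ).2 h⟩⟩

theorem wimp_or {α β : NForm} (h₁ : N3Derives Γ (wimp α χ)) (h₂ : N3Derives Γ (wimp β χ)) :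
    N3Derives Γ (wimp (or α β) χ) :=
  h₂.mp (h₁.mp (NDerives.N8 _ _ _))

theorem imp_contrapose :
    N3Derives Γ (NForm.iff (imp φ ψ) (imp (neg ψ) (neg φ))) := by
  simp only [iff_iff, imp_iff, neg_imp_iff, neg_neg_iff]
  grind

theorem nelson (α β : NForm) :
    N3Derives Γ (imp (and (imp (NForm.sq α) β) (imp (NForm.sq (neg β)) (neg α))) (imp α β)) := by
  simp only [imp_iff, neg_imp_iff, and_iff, sq_iff]
  refine fun Δ _ => ⟨by grind, fun h => neg_and_iff.2 (or_left ?_)⟩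
  exact neg_imp_iff.2 ⟨sq_iff.2 h.1, h.2⟩

theorem neg_imp_imp_and : N3Derives Γ (imp (neg (imp φ ψ)) (and φ (neg ψ))) := by
  refine imp_iff.2 fun Δ _ => ⟨fun h => and_iff.2 (neg_imp_iff.1 h), fun h => ?_⟩
  rw [neg_neg_iff]
  refine (neg_and_iff.1 h).or_elim (fun E _ h' => ?_) (fun E _ h' => ?_)
  · exact imp_iff.2 fun F hF => ⟨exfalso (h'.mono hF), fun _ => h'.mono hF⟩
  · have h' := neg_neg_iff.1 h'
    exact imp_iff.2 fun F hF => ⟨fun _ => h'.mono hF, fun h => exfalso h (h'.mono hF)⟩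

theorem imp_of_iff (h₁ : ∀ Δ, N3Derives Δ φ → N3Derives Δ ψ)
    (h₂ : ∀ Δ, N3Derives Δ (neg ψ) → N3Derives Δ (neg φ)) : N3Derives Γ (imp φ ψ) :=
  imp_iff.2 fun Δ _ => ⟨h₁ Δ, h₂ Δ⟩

theorem imp_of_right (h : N3Derives Γ ψ) : N3Derives Γ (imp φ ψ) :=
  imp_iff.2 fun _ hΔ => ⟨fun _ => h.mono hΔ, fun h' => exfalso h' (h.mono hΔ)⟩

theorem of_sDerives {Ax Γ' : Set SForm} (hAx : ∀ γ ∈ Ax, N3Derives Γ γ.toN)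
    (hΓ : ∀ γ ∈ Γ', N3Derives Γ γ.toN) {α : SForm}
    (h : SDerives Ax Γ' α) : N3Derives Γ α.toN := by
  induction h with
  | extra h => exact hAx _ h
  | prem h => exact hΓ _ h
  | A1 φ => exact imp_of_iff (fun _ => id) (fun _ => id)
  | A2 ψ =>
    exact imp_of_iff (fun Δ h => exfalso h (one Δ)) (fun Δ _ => neg_neg_iff.2 (one Δ))
  | A3 φ =>
    refine imp_of_iff (fun Δ h => ?_) (fun Δ h => neg_neg_iff.2 (neg_imp_iff.1 h).1)
    exact imp_iff.2 fun E hE => ⟨fun h' => exfalso (h.mono hE) h', fun _ => h.mono hE⟩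
  | A4 => exact neg_neg_iff.2 (one Γ)
  | A5 φ ψ => exact imp_contrapose
  | P G _ ih => exact imp_mp (impL_mono G imp_swap) ih
  | C _ ih =>
    simp only [SForm.toN] at ih ⊢
    rw [imp2_iff, wimp_iff] at ih ⊢
    intro Δ hΔ h
    exact imp_mp (ih Δ hΔ h) h
  | E G _ _ ih₁ ih₂ => exact imp_mp (impL_mono G ih₂) ih₁
  | impl G _ _ ih₁ ih₂ =>
    refine imp_mp (impL_mono G ?_) ih₁
    simp only [SForm.toN, imp_iff, neg_imp_iff] at *
    grind [mono]
  | impr φ _ ih => exact imp_of_right ih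
  | andl1 ψ _ ih =>
    exact imp_trans (imp_of_iff (fun _ h => (and_iff.1 h).1)
      (fun _ h => neg_and_iff.2 (or_left h))) ih
  | andl2 φ _ ih =>
    exact imp_trans (imp_of_iff (fun _ h => (and_iff.1 h).2)
      (fun _ h => neg_and_iff.2 (or_right h))) ih
  | andr G _ _ ih₁ ih₂ => exact imp_mp (impL_and G) (and_iff.2 ⟨ih₁, ih₂⟩)
  | orl1 _ _ ih₁ ih₂ => exact imp_or ih₁ ih₂
  | orl2 _ _ ih₁ ih₂ => exact imp2_iff.2 (wimp_or (imp2_iff.1 ih₁) (imp2_iff.1 ih₂))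
  | orr1 G ψ _ ih =>
    exact imp_mp (impL_mono G
      (imp_of_iff (fun _ h => or_left h) (fun _ h => (neg_or_iff.1 h).1))) ih
  | orr2 G φ _ ih =>
    exact imp_mp (impL_mono G
      (imp_of_iff (fun _ h => or_right h) (fun _ h => (neg_or_iff.1 h).2))) ih
  | negimpl _ ih => exact imp_trans neg_imp_imp_and ih
  | negimpr G _ ih =>
    refine ih.mp (imp2L_mono G (wimp_iff.2 fun Δ _ h => ?_))
    exact neg_imp_iff.2 (and_iff.1 h)
  | negandl _ ih =>
    refine imp_trans (imp_of_iff (fun _ => neg_and_iff.1) fun _ h => ?_) ih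
    simpa only [SForm.toN, neg_or_iff, neg_neg_iff, and_iff] using h
  | negandr G _ ih =>
    refine imp_mp (impL_mono G (imp_of_iff (fun _ => neg_and_iff.2) fun _ h => ?_)) ih
    simpa only [SForm.toN, neg_or_iff, neg_neg_iff, and_iff] using h
  | @negorl φ ψ _ _ ih =>
    refine imp_trans (imp_of_iff (fun _ h => and_iff.2 (neg_or_iff.1 h)) fun _ h => ?_) ih
    refine neg_neg_iff.2 ?_
    exact (neg_and_iff.1 h).or_elim (fun _ _ h => or_left (neg_neg_iff.1 h))
      (fun _ _ h => or_right (neg_neg_iff.1 h))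
  | negorr G _ ih =>
    refine imp_mp (impL_mono G (imp_of_iff (fun _ h => ?_) fun _ h => neg_and_iff.2 ?_)) ih
    · exact neg_or_iff.2 (and_iff.1 h)
    exact (neg_neg_iff.1 h).or_elim (fun _ _ h => or_left (neg_neg_iff.2 h))
      (fun _ _ h => or_right (neg_neg_iff.2 h))
  | negnegl _ ih =>
    exact imp_trans (imp_of_iff (fun _ => neg_neg_iff.1) fun _ => neg_neg_iff.2) ih
  | negnegr G _ ih =>
    exact imp_mp (impL_mono G (imp_of_iff (fun _ => neg_neg_iff.2) fun _ => neg_neg_iff.1)) ih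

/-- The readings differ only at `1`, which becomes `¬0`, hence a double negation. Strong implication
looks at negations and larger premise sets, so the induction carries both. -/
theorem toN_toS (φ : Form) : ∀ Γ, (N3Derives Γ φ.toS.toN ↔ N3Derives Γ φ.toN) ∧
    (N3Derives Γ (neg φ.toS.toN) ↔ N3Derives Γ (neg φ.toN)) := by
  induction φ with
  | var n => exact fun _ => ⟨Iff.rfl, Iff.rfl⟩
  | and φ ψ ih₁ ih₂ =>
    intro Γ
    simp only [Form.toS, Form.toN, SForm.toN, and_iff, neg_and_iff, or_iff, ih₁, ih₂, and_self]
  | or φ ψ ih₁ ih₂ =>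
    intro Γ
    simp only [Form.toS, Form.toN, SForm.toN, neg_or_iff, or_iff, ih₁, ih₂, and_self]
  | imp φ ψ ih₁ ih₂ =>
    intro Γ
    simp only [Form.toS, Form.toN, SForm.toN, neg_imp_iff, imp_iff, ih₁, ih₂, and_self]
  | neg φ ih =>
    intro Γ
    simp only [Form.toS, Form.toN, SForm.toN, neg_neg_iff, ih, and_self]
  | zero => exact fun _ => ⟨Iff.rfl, Iff.rfl⟩
  | one => exact fun _ => ⟨neg_neg_iff, neg_neg_iff⟩

theorem of_sNelson {Γ : Set Form} {φ : Form} (h : SNelson (Form.toS '' Γ) φ.toS) :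
    N3Derives (Form.toN '' Γ) φ.toN := by
  refine (toN_toS φ _).1.1 (of_sDerives ?_ ?_ h)
  · rintro _ ⟨α, β, rfl⟩
    exact nelson _ _
  · rintro _ ⟨γ, hγ, rfl⟩
    exact (toN_toS γ _).1.2 (NDerives.prem ⟨γ, hγ, rfl⟩)

end N3Derives

/-! ### Structural rules of `S` and the behaviour of `⇒²`. -/

namespace SDerives

open SForm

variable {Ax Γ : Set SForm} {G H : List SForm} {φ φ' ψ ψ' γ : SForm}

theorem impL_append (G H : List SForm) (γ : SForm) : impL (G ++ H) γ = impL G (impL H γ) :=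
  List.foldr_append

theorem imp2L_eq_impL (G : List SForm) (γ : SForm) :
    imp2L G γ = impL (G.flatMap fun φ => [φ, φ]) γ := by
  induction G with
  | nil => rfl
  | cons φ G ih => exact congrArg (imp2 φ) ih

theorem perm (h : G.Perm H) : ∀ F : List SForm,
    SDerives Ax Γ (impL F (impL G γ)) → SDerives Ax Γ (impL F (impL H γ)) := by
  induction h with
  | nil => exact fun _ => id
  | @cons x l₁ l₂ _ ih =>
    intro F h
    have := ih (F ++ [x])
    simp only [impL_append] at this
    exact this h
  | swap x y l => exact fun F => P F
  | trans _ _ ih₁ ih₂ => exact fun F h => ih₂ F (ih₁ F h)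

theorem exchange (h : G.Perm H) (hG : SDerives Ax Γ (impL G γ)) : SDerives Ax Γ (impL H γ) :=
  perm h [] hG

theorem cut (h₁ : SDerives Ax Γ (impL G φ)) (h₂ : SDerives Ax Γ (impL (φ :: H) γ)) :
    SDerives Ax Γ (impL (G ++ H) γ) := by
  rw [impL_append]
  exact E G h₁ h₂

theorem imp_mp (h₁ : SDerives Ax Γ φ) (h₂ : SDerives Ax Γ (imp φ ψ)) : SDerives Ax Γ ψ :=
  E [] h₁ h₂

theorem imp_trans (h₁ : SDerives Ax Γ (imp φ ψ)) (h₂ : SDerives Ax Γ (imp ψ γ)) :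
    SDerives Ax Γ (imp φ γ) :=
  E [φ] h₁ h₂

theorem weaken (F : List SForm) (h : SDerives Ax Γ (impL G γ)) :
    SDerives Ax Γ (impL (F ++ G) γ) := by
  induction F with
  | nil => exact h
  | cons φ _ ih => exact impr φ ih

theorem elim (h₁ : SDerives Ax Γ (impL G φ)) (h₂ : SDerives Ax Γ (impL H (imp φ ψ))) :
    SDerives Ax Γ (impL (G ++ H) ψ) := by
  refine cut h₁ (exchange (List.perm_append_singleton φ H) ?_)
  rw [impL_append]
  exact h₂

theorem absorb (h : φ ∈ G)
    (hd : SDerives Ax Γ (impL (φ :: G.flatMap fun φ => [φ, φ]) γ)) :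
    SDerives Ax Γ (impL (G.flatMap fun φ => [φ, φ]) γ) := by
  obtain ⟨G₁, G₂, rfl⟩ := List.append_of_mem h
  have hp : ((G₁ ++ φ :: G₂).flatMap fun φ => [φ, φ]).Perm
      (φ :: φ :: (G₁ ++ G₂).flatMap fun φ => [φ, φ]) :=
    List.Perm.flatMap_right (fun φ => [φ, φ]) List.perm_middle
  exact exchange hp.symm (C (exchange (hp.cons φ) hd))

/-- Antecedents that occur twice may be used any number of times. -/
theorem contract (h : G ⊆ H) (hd : SDerives Ax Γ (impL G γ)) : SDerives Ax Γ (imp2L H γ) := by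
  rw [imp2L_eq_impL]
  -- Once two copies of every member of `H` are present, each member of `G` is a third copy,
  -- removable by `C`.
  replace hd := weaken (H.flatMap fun φ => [φ, φ]) hd
  induction G with
  | nil => simpa using hd
  | cons φ G ih =>
    rw [List.cons_subset] at h
    refine ih h.2 ?_
    rw [impL_append]
    refine absorb h.1 ?_
    rw [← impL_append]
    exact exchange List.perm_middle hd

theorem assume (h : φ ∈ G) : SDerives Ax Γ (imp2L G φ) :=
  contract (G := [φ]) (by simpa using h) (A1 φ)

theorem wimp_mp (h₁ : SDerives Ax Γ (imp2L G φ)) (h₂ : SDerives Ax Γ (imp2L G (imp2 φ ψ))) :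
    SDerives Ax Γ (imp2L G ψ) := by
  rw [imp2L_eq_impL] at h₁ h₂
  refine contract (fun x hx => ?_) (elim h₁ (elim h₁ h₂))
  simpa using hx

theorem imp2L_imp (h₁ : SDerives Ax Γ (imp2L G φ)) (h₂ : SDerives Ax Γ (imp φ ψ)) :
    SDerives Ax Γ (imp2L G ψ) := by
  rw [imp2L_eq_impL] at *
  exact E _ h₁ h₂

theorem imp2L_and (h₁ : SDerives Ax Γ (imp2L G φ)) (h₂ : SDerives Ax Γ (imp2L G ψ)) :
    SDerives Ax Γ (imp2L G (and φ ψ)) := by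
  rw [imp2L_eq_impL] at *
  exact andr _ h₁ h₂

theorem and_left (φ ψ : SForm) : SDerives Ax Γ (imp (and φ ψ) φ) := andl1 ψ (A1 φ)

theorem and_right (φ ψ : SForm) : SDerives Ax Γ (imp (and φ ψ) ψ) := andl2 φ (A1 ψ)

theorem wiff_intro (h₁ : SDerives Ax Γ (imp φ ψ)) (h₂ : SDerives Ax Γ (imp ψ φ)) :
    SDerives Ax Γ (and (imp2 φ ψ) (imp2 ψ φ)) :=
  andr [] (impr φ h₁) (impr ψ h₂)

theorem neg_neg_imp (φ : SForm) : SDerives Ax Γ (imp (neg (neg φ)) φ) := negnegl (A1 φ)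

theorem imp_neg_neg (φ : SForm) : SDerives Ax Γ (imp φ (neg (neg φ))) := negnegr [φ] (A1 φ)

theorem contrapose (φ ψ : SForm) :
    SDerives Ax Γ (imp (imp φ ψ) (imp (neg ψ) (neg φ))) :=
  imp_mp (A5 φ ψ) (and_left _ _)

theorem or_imp2 (φ ψ γ : SForm) : SDerives Ax Γ (imp2L [imp2 φ γ, imp2 ψ γ, or φ ψ] γ) := by
  have h₁ : SDerives Ax Γ (imp2L [φ, imp2 φ γ, imp2 ψ γ] γ) :=
    wimp_mp (φ := φ) (assume (by simp)) (assume (by simp))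
  have h₂ : SDerives Ax Γ (imp2L [ψ, imp2 φ γ, imp2 ψ γ] γ) :=
    wimp_mp (φ := ψ) (assume (by simp)) (assume (by simp))
  -- The rule `orl2` needs the doubled disjunction outermost; exchange then moves it behind the two
  -- implications.
  exact exchange (List.perm_append_comm (l₁ := [or φ ψ, or φ ψ])
    (l₂ := [imp2 φ γ, imp2 φ γ, imp2 ψ γ, imp2 ψ γ])) (orl2 h₁ h₂)

theorem imp2_distrib (φ ψ γ : SForm) :
    SDerives Ax Γ (imp2L [imp2 φ (imp2 ψ γ), imp2 φ ψ, φ] γ) := by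
  refine wimp_mp (φ := ψ) ?_ ?_ <;>
    exact wimp_mp (φ := φ) (assume (by simp)) (assume (by simp))

theorem imp2_and (φ ψ γ : SForm) :
    SDerives Ax Γ (imp2L [imp2 φ ψ, imp2 φ γ, φ] (and ψ γ)) := by
  refine imp2L_and ?_ ?_ <;>
    exact wimp_mp (φ := φ) (assume (by simp)) (assume (by simp))

theorem neg_imp2_imp (φ ψ : SForm) :
    SDerives Ax Γ (imp2 (neg (imp2 φ ψ)) (and φ (neg ψ))) :=
  impr _ (negimpl (andr [_] (and_left _ _) (andl2 _ (negimpl (and_right _ _)))))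

theorem imp_neg_imp2 (φ ψ : SForm) :
    SDerives Ax Γ (imp2 (and φ (neg ψ)) (neg (imp2 φ ψ))) :=
  have h : SDerives Ax Γ (imp2L [and φ (neg ψ)] (and φ (neg ψ))) := assume (by simp)
  negimpr [and φ (neg ψ)] (imp2L_and (imp2L_imp h (and_left _ _)) (negimpr [and φ (neg ψ)] h))

theorem neg_imp2_self (φ ψ : SForm) : SDerives Ax Γ (imp2L [neg φ, φ] ψ) :=
  contract (List.Subset.refl _) (E [neg φ, φ] (A3 φ) (A2 ψ))

/-- Contraposing inside gives `φ ⇒ (¬ψ ⇒ ¬φ)`, exchange gives `¬ψ ⇒ (φ ⇒ ¬φ)`, and contraposing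
again gives `φ² ⇒ ¬¬ψ`. -/
theorem imp2_imp_sq (φ ψ : SForm) : SDerives Ax Γ (imp (imp2 φ ψ) (imp (sq φ) ψ)) := by
  have h : SDerives Ax Γ (impL [imp2 φ ψ, φ] (imp (neg ψ) (neg φ))) :=
    E [imp2 φ ψ, φ] (A1 (imp2 φ ψ)) (contrapose φ ψ)
  have h := E [imp2 φ ψ] (P [imp2 φ ψ] h) (contrapose (neg ψ) (imp φ (neg φ)))
  exact E [imp2 φ ψ, sq φ] h (neg_neg_imp ψ)

theorem neg_congr (h : SDerives Ax Γ (imp φ ψ)) : SDerives Ax Γ (imp (neg ψ) (neg φ)) :=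
  imp_mp h (contrapose φ ψ)

theorem and_congr (h₁ : SDerives Ax Γ (imp φ φ')) (h₂ : SDerives Ax Γ (imp ψ ψ')) :
    SDerives Ax Γ (imp (and φ ψ) (and φ' ψ')) :=
  andr [_] (andl1 ψ h₁) (andl2 φ h₂)

theorem or_congr (h₁ : SDerives Ax Γ (imp φ φ')) (h₂ : SDerives Ax Γ (imp ψ ψ')) :
    SDerives Ax Γ (imp (or φ ψ) (or φ' ψ')) :=
  orl1 (orr1 [_] ψ' h₁) (orr2 [_] φ' h₂)

theorem imp_congr (h₁ : SDerives Ax Γ (imp φ' φ)) (h₂ : SDerives Ax Γ (imp ψ ψ')) :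
    SDerives Ax Γ (imp (imp φ ψ) (imp φ' ψ')) :=
  P [] (impl [φ'] h₁ h₂)

end SDerives

/-! ### Interpretation of `N3` in `S` with the Nelson axiom. -/

namespace NForm

/-- Reading of the formulas of `N3` in `S`, with the weak implication read as `⇒²`. -/
def toS : NForm → SForm
  | var n => SForm.var n
  | and φ ψ => SForm.and φ.toS ψ.toS
  | or φ ψ => SForm.or φ.toS ψ.toS
  | wimp φ ψ => SForm.imp2 φ.toS ψ.toS
  | neg φ => SForm.neg φ.toS

end NForm

namespace SNelson

open SForm SDerives

/-- The sole direct use of the Nelson axiom, after each `⇒²` is turned into an implication from a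
square. -/
theorem strong_imp {Γ : Set SForm} (φ ψ : SForm) :
    SNelson Γ (imp (and (imp2 φ ψ) (imp2 (neg ψ) (neg φ))) (imp φ ψ)) :=
  SDerives.imp_trans (SDerives.and_congr (imp2_imp_sq _ _) (imp2_imp_sq _ _))
    (SDerives.extra ⟨φ, ψ, rfl⟩)

theorem imp_strong {Γ : Set SForm} (φ ψ : SForm) :
    SNelson Γ (imp (imp φ ψ) (and (imp2 φ ψ) (imp2 (neg ψ) (neg φ)))) :=
  SDerives.andr [_] (P [] (impr φ (A1 _)))
    (P [] (impr (neg ψ) (contrapose φ ψ)))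

theorem of_n3Derives {Γ : Set SForm} {Γ' : Set NForm} (hΓ : ∀ γ ∈ Γ', SNelson Γ γ.toS)
    {φ : NForm} (h : N3Derives Γ' φ) : SNelson Γ φ.toS := by
  unfold N3Derives at h
  induction h with
  | extra h =>
    obtain ⟨α, β, rfl⟩ := h
    exact neg_imp2_self _ _
  | prem h => exact hΓ _ h
  | N1 φ ψ => exact assume (G := [φ.toS, ψ.toS]) (by simp)
  | N2 φ ψ γ => exact imp2_distrib _ _ _
  | N3 φ ψ => exact impr _ (and_left _ _)
  | N4 φ ψ => exact impr _ (and_right _ _)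
  | N5 φ ψ γ => exact imp2_and _ _ _
  | N6 φ ψ => exact impr _ (orr1 [_] _ (A1 _))
  | N7 φ ψ => exact impr _ (orr2 [_] _ (A1 _))
  | N8 φ ψ γ => exact or_imp2 _ _ _
  | N9 φ => exact wiff_intro (neg_neg_imp _) (imp_neg_neg _)
  | N10 φ ψ => exact wiff_intro (negorl (A1 _)) (negorr [_] (A1 _))
  | N11 φ ψ => exact wiff_intro (negandl (A1 _)) (negandr [_] (A1 _))
  | N12 φ ψ => exact andr [] (neg_imp2_imp _ _) (imp_neg_imp2 _ _)
  | mp _ _ ih₁ ih₂ => exact imp_mp ih₁ (imp_mp ih₁ ih₂)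

theorem toS_toN (Γ : Set SForm) (φ : Form) :
    SNelson Γ (imp φ.toN.toS φ.toS) ∧ SNelson Γ (imp φ.toS φ.toN.toS) := by
  have h_one : SNelson Γ NForm.one.toS := impr _ (A1 _)
  induction φ with
  | var n => exact ⟨A1 _, A1 _⟩
  | and φ ψ ih₁ ih₂ => exact ⟨and_congr ih₁.1 ih₂.1, and_congr ih₁.2 ih₂.2⟩
  | or φ ψ ih₁ ih₂ => exact ⟨or_congr ih₁.1 ih₂.1, or_congr ih₁.2 ih₂.2⟩
  | imp φ ψ ih₁ ih₂ =>
    exact ⟨SDerives.imp_trans (strong_imp _ _) (SDerives.imp_congr ih₁.2 ih₂.1),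
      SDerives.imp_trans (SDerives.imp_congr ih₁.1 ih₂.2) (imp_strong _ _)⟩
  | neg φ ih => exact ⟨neg_congr ih.2, neg_congr ih.1⟩
  | zero =>
    -- Contraposing `¬0 ⇒ (p₀ ⇒² p₀)` sends the translated `0` to `¬¬0`, hence to `0`.
    exact ⟨SDerives.imp_trans (neg_congr (impr SForm.one h_one)) (neg_neg_imp _), A2 _⟩
  | one => exact ⟨impr _ A4, impr _ h_one⟩

theorem of_n3Derives_toN {Γ : Set Form} {φ : Form} (h : N3Derives (Form.toN '' Γ) φ.toN) :
    SNelson (Form.toS '' Γ) φ.toS := by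
  refine imp_mp (of_n3Derives ?_ h) (toS_toN _ φ).1
  rintro _ ⟨γ, hγ, rfl⟩
  exact imp_mp (SDerives.prem ⟨γ, hγ, rfl⟩) (toS_toN _ γ).2

end SNelson

/-- Over the language `⟨∧, ∨, ⇒, ¬, 0, 1⟩`, the consequence relation of `N3` is that of the
axiomatic strengthening of `S` by the Nelson axiom; and this language is as expressive as the
original language of `N3`, because `φ → ψ` is equivalent in `N3` to `φ² ⇒ ψ`. -/
theorem mainTheorem10 :
    (∀ (Γ : Set Form) (φ : Form),
      N3Derives (Form.toN '' Γ) φ.toN ↔ SNelson (Form.toS '' Γ) φ.toS) ∧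
    (∀ φ ψ : NForm,
      N3Derives ∅ (NForm.iff (NForm.wimp φ ψ) (NForm.imp (NForm.sq φ) ψ))) :=
  ⟨fun _ _ => ⟨SNelson.of_n3Derives_toN, N3Derives.of_sNelson⟩,
    fun φ ψ => N3Derives.wimp_iff_imp_sq φ ψ⟩
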